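/- Let $0<b<a$ be real numbers, let $\eta_n=(-1)^{s(n)}$ where $s(n)$ is the sum of the binary digits of $n$, and put $f(n)=\sum_{0\le m<n}\bigl(\tfrac{a+b}{2}+\tfrac{a-b}{2}\eta_m\bigr)$ for $n\ge 1$. Consider the Dirac comb $\mu=\sum_{n\ge1}\delta_{f(n)}$. An averaging sequence of finite approximants is $\mathcal U=(U_l)_{l\ge0}$ with $U_l=\rho_lJ\cap\{f(n): n\ge1\}$, where $J$ is a compact interval whose interior contains $0$ and $(\rho_l)$ is a strictly increasing sequence of positive reals tending to $+\infty$. Put $$\nu_{\mathcal U,l}(k)=\frac1{\mathrm{card}(U_l)}\Bigl|\sum_{f(n)\in U_l}e^{-ikf(n)}\Bigr|^2 .$$ An AGL exponent at $k$ is an $\alpha\in(-1,1)$ such that, for every averaging sequence $\mathcal U$, the numbers $L^-=\liminf_l \nu_{\mathcal U,l}(k)/\mathrm{card}(U_l)^{\alpha}$ and $L^+=\limsup_l \nu_{\mathcal U,l}(k)/\mathrm{card}(U_l)^{\alpha}$ satisfy $0<L^-\le L^+<\infty$ if $L^-\ne0$, and $0<L^+<\infty$ if $L^-=0$. For a given $\alpha$,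 an averaging sequence $\mathcal V$ has the extinction property at $k$ if $\nu_{\mathcal V,i}(k)/\mathrm{card}(V_i)^{\alpha}\to0$ as $i\to\infty$. For $m\in\mathbb Z$ let $c_m(k)=\int_0^1 e^{-2ik(a-b)x}e^{-2\pi imx}\,dx$, and let $\kappa_\eta(k)=\lim_{N\to\infty}\sum_{|m|\le N,\ m\text{ odd}}c_m(k)$. Let $\mathbb S$ be the set of all $k=\frac{4\pi}{a+b}\frac{t}{2^hp}$ with $t\in\mathbb Z$, $h\ge0$, $p\ge3$ odd, $\gcd(t,2^hp)=1$ and $\kappa_\eta(k)\ne0$. For odd $p\ge3$ let $S_{p,i}(n)=\sum_{0\le j<n,\ j\equiv i\,(p)}\eta_j$, let $s$ be the order of $2$ modulo $p$, let $\lambda_1$ be the largest modulus of an eigenvalue of the matrix $(S_{p,i-j}(2^s))_{0\le i,j\le p-1}$, and let $\beta=\frac{\log\lambda_1}{s\log2}$. Let $r$ be the least positive integer with $z^r=\lambda_1^r$ for all eigenvalues $z$ of modulus $\lambda_1$. For $0\le j<p$ let $$\psi_{p,j}(x)=\lim_{m\to\infty}\frac{S_{p,j}\bigl(\lfloor 2^{rs(x+m)}\rfloor\bigr)}{2^{rs(x+m)\beta}},$$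 which is the function of period $1$ with $S_{p,j}(n)=n^\beta\psi_{p,j}\bigl(\frac{\log n}{rs\log 2}\bigr)+o(n^\beta)$. For $k=\frac{4\pi}{a+b}\frac tp$ with $\gcd(t,p)=1$, the rarefaction domain is $$R(k)=\Bigl\{\sum_{j=0}^{p-1}y_j\,e^{-2\pi ijt/p}\ :\ \inf_{[0,1]}\psi_{p,j}\le y_j\le\sup_{[0,1]}\psi_{p,j}\Bigr\}.$$ Let $p\ge3$ be odd, $\gcd(t,p)=1$ and $k=\frac{4\pi}{a+b}\frac tp\in\mathbb S$. If $0\notin R(k)$, then $\alpha=2\beta-1$ is the unique AGL exponent at $k$, and no averaging sequence of finite approximants has the extinction property at $k$ for this $\alpha$. -/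

import Mathlib

namespace ThueMorse

noncomputable section

/-- The `±1` Prouhet-Thue-Morse sequence `η_n = (-1)^{s(n)}`, `s(n)` the binary sum of digits. -/
def eta (n : ℕ) : ℤ := (-1) ^ (Nat.digits 2 n).sum

/-- `f(n) = ∑_{0 ≤ m < n} ((a+b)/2 + (a-b)/2 · η_m)` for `n ≥ 0`, extended to `ℤ` as an odd
function. -/
def f (a b : ℝ) (n : ℤ) : ℝ :=
  (n.sign : ℝ) * ∑ m ∈ Finset.range n.natAbs, ((a + b) / 2 + (a - b) / 2 * (eta m : ℝ))

/-- The weight of the Dirac comb `μ = ∑_{n ≥ 1} δ_{f(n)}`. -/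
def weight (n : ℤ) : ℂ := if 1 ≤ n then 1 else 0

/-- The points of the Thue-Morse quasicrystal that carry a nonzero weight. -/
def weightedPoints (a b : ℝ) : Set ℝ := f a b '' Function.support weight

/-- The data of an averaging sequence: a compact interval `J = [lo, hi]` whose interior contains
the origin, and a strictly increasing sequence of positive dilation factors tending to infinity. -/
structure AveragingSequence where
  lo : ℝ
  hi : ℝ
  lo_neg : lo < 0
  hi_pos : 0 < hi
  ρ : ℕ → ℝ
  ρ_pos : ∀ l, 0 < ρ l
  ρ_strictMono : StrictMono ρ
  ρ_tendsto : Filter.Tendsto ρ Filter.atTop Filter.atTop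

/-- The finite approximant `U_l = ρ_l J ∩ Λ^{supp(ω)}`. -/
def AveragingSequence.approximant (U : AveragingSequence) (a b : ℝ) (l : ℕ) : Set ℝ :=
  ((fun x : ℝ => U.ρ l * x) '' Set.Icc U.lo U.hi) ∩ weightedPoints a b

/-- The density at `k` of the `l`-th approximant measure:
`(1 / card U_l) |∑_{f(n) ∈ U_l} ω(n) e^{-i k f(n)}|^2`. -/
def nu (a b : ℝ) (U : AveragingSequence) (l : ℕ) (k : ℝ) : ℝ :=
  (1 / ((U.approximant a b l).ncard : ℝ)) *
    ‖∑ᶠ (n : ℤ) (_ : f a b n ∈ U.approximant a b l),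
        weight n * Complex.exp (-(Complex.I * (k : ℂ) * (f a b n : ℂ)))‖ ^ 2

/-- The normalized approximant density `ν_{U,l}(k) / card(U_l)^α`. -/
def nuNormalized (a b : ℝ) (U : AveragingSequence) (α : ℝ) (l : ℕ) (k : ℝ) : ℝ :=
  nu a b U l k / ((U.approximant a b l).ncard : ℝ) ^ α

/-- The Aubry-Godrèche-Luck condition: `α ∈ (-1, 1)` is a scaling exponent at `k`. -/
def IsAGLExponent (a b k α : ℝ) : Prop :=
  α ∈ Set.Ioo (-1 : ℝ) 1 ∧
  ∀ U : AveragingSequence,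
    let inf := Filter.liminf (fun l => ENNReal.ofReal (nuNormalized a b U α l k)) Filter.atTop
    let sup := Filter.limsup (fun l => ENNReal.ofReal (nuNormalized a b U α l k)) Filter.atTop
    (inf ≠ 0 → 0 < inf ∧ inf ≤ sup ∧ sup < ⊤) ∧ (inf = 0 → 0 < sup ∧ sup < ⊤)

/-- The extinction property at `k` of an averaging sequence, for the exponent `α`. -/
def HasExtinctionProperty (a b k α : ℝ) (V : AveragingSequence) : Prop :=
  Filter.Tendsto (fun i => nuNormalized a b V α i k) Filter.atTop (nhds 0)

/-- The Fourier coefficients `c_m(k)` of the 1-periodic function `x ↦ e^{-i k α₂ {x}}`, where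
`α₂ = 2(a - b)` and `{x}` is the fractional part. -/
def fourierCoefficient (a b : ℝ) (m : ℤ) (k : ℝ) : ℂ :=
  ∫ x in (0 : ℝ)..1,
    Complex.exp (-(Complex.I * (k : ℂ) * ((2 * (a - b) : ℝ) : ℂ) * ((Int.fract x : ℝ) : ℂ))) *
      Complex.exp (-(2 * (Real.pi : ℂ) * Complex.I * (m : ℂ) * (x : ℂ)))

/-- `κ_η(k) = ∑_{m odd} c_m(k)`, summed symmetrically as is usual for Fourier series (the series is
only conditionally convergent). -/
def kappaEta (a b k : ℝ) : ℂ :=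
  Filter.limUnder Filter.atTop (fun N : ℕ =>
    ∑ m ∈ (Finset.Icc (-(N : ℤ)) (N : ℤ)).filter (fun m => Odd m), fourierCoefficient a b m k)

/-- The set `𝕊` of wave vectors `(4π/(a+b)) · t/(2^h p)` with `p ≥ 3` odd, `gcd(t, 2^h p) = 1` and
`κ_η ≠ 0`. -/
def singularSet (a b : ℝ) : Set ℝ :=
  {k | ∃ (t : ℤ) (p h : ℕ), Odd p ∧ 3 ≤ p ∧ IsCoprime t ((2 : ℤ) ^ h * (p : ℤ)) ∧
    k = 4 * Real.pi / (a + b) * ((t : ℝ) / (2 ^ h * (p : ℝ))) ∧ kappaEta a b k ≠ 0}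

/-- The `p`-rarefied sum `S_{p,i}(n) = ∑_{0 ≤ j < n, j ≡ i (mod p)} η_j`. -/
def rarefiedSum (p : ℕ) (i : ℤ) (n : ℕ) : ℤ :=
  ∑ j ∈ (Finset.range n).filter (fun j : ℕ => (j : ℤ) ≡ i [ZMOD (p : ℤ)]), eta j

/-- `s`, the order of `2` modulo `p`. -/
def orderTwo (p : ℕ) : ℕ := orderOf (2 : ZMod p)

/-- The matrix `M = (S_{p,i-j}(2^s))_{0 ≤ i,j ≤ p-1}`. -/
def rarefactionMatrix (p : ℕ) : Matrix (Fin p) (Fin p) ℂ :=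
  Matrix.of fun i j => (rarefiedSum p ((i : ℤ) - (j : ℤ)) (2 ^ orderTwo p) : ℂ)

/-- `λ₁`, the largest modulus of an eigenvalue of `M`. -/
def lambdaOne (p : ℕ) : ℝ := sSup ((fun z : ℂ => ‖z‖) '' spectrum ℂ (rarefactionMatrix p))

/-- The exponent `β = log λ₁ / (s log 2)`. -/
def beta (p : ℕ) : ℝ := Real.log (lambdaOne p) / ((orderTwo p : ℝ) * Real.log 2)

/-- The exponent `α = 2β - 1`. -/
def alpha (p : ℕ) : ℝ := 2 * beta p - 1

/-- `r`, the least positive integer such that `z^r = λ₁^r` for every eigenvalue `z` of `M` of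
maximal modulus. -/
def rIndex (p : ℕ) : ℕ :=
  sInf {r : ℕ | 0 < r ∧ ∀ z ∈ spectrum ℂ (rarefactionMatrix p),
    ‖z‖ = lambdaOne p → z ^ r = (lambdaOne p : ℂ) ^ r}

/-- The fractal function `ψ_{p,j}` of period 1 governing the rarefied sums,
`S_{p,j}(n) = n^β ψ_{p,j}(log n / (r s log 2)) + o(n^β)`. It is given explicitly as the limit of
`S_{p,j}(⌊X_m⌋) / X_m^β` for `X_m = 2^{r s (x + m)}`, that is `log X_m / (r s log 2) = x + m`; a
continuous function of period 1 with the displayed asymptotics has to be this limit. -/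
def psi (p j : ℕ) (x : ℝ) : ℝ :=
  Filter.limUnder Filter.atTop (fun m : ℕ =>
    (rarefiedSum p (j : ℤ) ⌊(2 : ℝ) ^ ((rIndex p : ℝ) * (orderTwo p : ℝ) * (x + (m : ℝ)))⌋₊ : ℝ) /
      ((2 : ℝ) ^ ((rIndex p : ℝ) * (orderTwo p : ℝ) * (x + (m : ℝ)))) ^ beta p)

/-- The rarefaction domain `R(k)` at `k = (4π/(a+b)) t/p`: all sums `∑_{j<p} y_j ξ^j` with
`ξ = e^{-2πi t/p}` and `y_j` between the infimum and the supremum of `ψ_{p,j}` on `[0,1]`. -/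
def rarefactionDomain (p : ℕ) (t : ℤ) : Set ℂ :=
  {z | ∃ y : Fin p → ℝ,
    (∀ j : Fin p, y j ∈ Set.Icc (sInf (psi p j '' Set.Icc 0 1)) (sSup (psi p j '' Set.Icc 0 1))) ∧
    z = ∑ j : Fin p, (y j : ℂ) *
      Complex.exp (-(2 * (Real.pi : ℂ) * Complex.I * (t : ℂ) / (p : ℂ))) ^ (j : ℕ)}

end

end ThueMorse

/-!
For a `p`-th root of unity `ξ` the exponential sum `T_ξ(n) = ∑_{m < n} η_m ξ^m` is self-similar up
to a bounded error, `T_ξ(2^s N + c) = T_ξ(2^s) T_ξ(N) + O(1)` for `c < 2^s`, because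
`η_{2^s N + c} = η_N η_c` and `ξ^{2^s} = ξ`. The factors `T_ξ(2^s)` are the eigenvalues of the
rarefaction matrix, which the Vandermonde matrix of the roots of unity diagonalizes. Since
`λ₁ > 1`, dividing by powers of `λ₁^r` gives uniform limits; Fourier inversion on `ℤ/p` turns them
into the functions `ψ_{p,j}`, and `n^{-β} T_ξ(n)` approaches the compact set `R(k)` when
`ξ = e^{-2πi t/p}`. So `0 ∉ R(k)` forces `|T_ξ(n)| ≍ n^β`.

As `f(2m) = (a + b) m` and the spacings take two values, the sum of `e^{-ikf(n)}` over the first `n`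
points is `c T_ξ(n) + O(1)`, where `c` is a nonzero multiple of `sin(k(a - b)/2)`. The sine is
nonzero, for otherwise all the odd Fourier coefficients in `κ_η(k)` would vanish. Hence
`ν_{U,l}(k) ≍ card(U_l)^{2β-1}` for every averaging sequence.
-/

namespace ThueMorse

open Asymptotics Filter Finset Topology

section LinearRecursion

variable {𝕜 E X : Type*} [NormedField 𝕜] [NormedAddCommGroup E] [NormedSpace 𝕜 E] {B : ℝ}
  {y : ℕ → X → E} {S : Set X}

theorem tendstoUniformlyOn_of_dist_le {ι M : Type*} [PseudoMetricSpace M] {F : ι → X → M}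
    {G : X → M} {l : Filter ι} {ε : ι → ℝ} (hε : Tendsto ε l (𝓝 0))
    (hF : ∀ i, ∀ x ∈ S, dist (F i x) (G x) ≤ ε i) : TendstoUniformlyOn F G l S := by
  refine Metric.tendstoUniformlyOn_iff.2 fun δ hδ => ?_
  filter_upwards [hε.eventually_lt_const hδ] with i hi x hx
  rw [dist_comm]
  exact (hF i x hx).trans_lt hi

theorem exists_tendstoUniformlyOn_inv_pow_smul [CompleteSpace E] {Λ : 𝕜} (hΛ : 1 < ‖Λ‖)
    (hy : ∀ m, ∀ x ∈ S, ‖y (m + 1) x - Λ • y m x‖ ≤ B) :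
    ∃ L : X → E, TendstoUniformlyOn (fun m x => (Λ ^ m)⁻¹ • y m x) L atTop S := by
  have hr : ‖Λ‖⁻¹ < 1 := inv_lt_one_of_one_lt₀ hΛ
  have hΛ0 : Λ ≠ 0 := norm_pos_iff.1 (one_pos.trans hΛ)
  have hdist : ∀ x ∈ S, ∀ m, dist ((Λ ^ m)⁻¹ • y m x) ((Λ ^ (m + 1))⁻¹ • y (m + 1) x) ≤
      B * ‖Λ‖⁻¹ * ‖Λ‖⁻¹ ^ m := by
    intro x hx m
    have hdiff : (Λ ^ (m + 1))⁻¹ • y (m + 1) x - (Λ ^ m)⁻¹ • y m x =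
        (Λ ^ (m + 1))⁻¹ • (y (m + 1) x - Λ • y m x) := by
      rw [smul_sub, smul_smul, pow_succ, mul_inv, mul_assoc, inv_mul_cancel₀ hΛ0, mul_one]
    rw [dist_comm, dist_eq_norm, hdiff, norm_smul, norm_inv, norm_pow, mul_assoc, ← pow_succ',
      inv_pow, mul_comm]
    exact mul_le_mul_of_nonneg_right (hy m x hx) (by positivity)
  have hlim : ∀ x, ∃ L, x ∈ S → Tendsto (fun m => (Λ ^ m)⁻¹ • y m x) atTop (𝓝 L) := by
    intro x
    by_cases hx : x ∈ S
    · obtain ⟨L, hL⟩ :=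
        cauchySeq_tendsto_of_complete (cauchySeq_of_le_geometric _ _ hr (hdist x hx))
      exact ⟨L, fun _ => hL⟩
    · exact ⟨0, fun h => absurd h hx⟩
  choose L hL using hlim
  refine ⟨L, tendstoUniformlyOn_of_dist_le ?_ fun m x hx =>
    dist_le_of_le_geometric_of_tendsto _ _ hr (hdist x hx) (hL x hx) m⟩
  simpa using ((tendsto_pow_atTop_nhds_zero_of_lt_one (by positivity) hr).const_mul
    (B * ‖Λ‖⁻¹)).div_const (1 - ‖Λ‖⁻¹)

theorem norm_le_mul_pow_of_norm_sub_smul_le {μ : 𝕜} {θ : ℝ} (hθ : 1 ≤ θ) (hμ : ‖μ‖ < θ)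
    {u : ℕ → E} (h0 : ‖u 0‖ ≤ B) (hu : ∀ m, ‖u (m + 1) - μ • u m‖ ≤ B) (m : ℕ) :
    ‖u m‖ ≤ (B / (θ - ‖μ‖) + B) * θ ^ m := by
  have hB : 0 ≤ B := (norm_nonneg _).trans h0
  have hgap : 0 < θ - ‖μ‖ := sub_pos.2 hμ
  set C := B / (θ - ‖μ‖) + B with hC
  have : 0 ≤ C := by positivity
  induction m with
  | zero => simpa [hC] using h0.trans (le_add_of_nonneg_left (by positivity))
  | succ m ih =>
    have hBC : B ≤ C * (θ - ‖μ‖) := by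
      rw [hC, add_mul, div_mul_cancel₀ _ hgap.ne']
      exact le_add_of_nonneg_right (by positivity)
    calc ‖u (m + 1)‖ ≤ ‖u (m + 1) - μ • u m‖ + ‖μ • u m‖ := norm_le_norm_sub_add _ _
      _ ≤ B + ‖μ‖ * (C * θ ^ m) := by rw [norm_smul]; gcongr; exact hu m
      _ ≤ C * (θ - ‖μ‖) * θ ^ m + ‖μ‖ * (C * θ ^ m) := by
        gcongr
        exact hBC.trans (le_mul_of_one_le_right (by positivity) (one_le_pow₀ hθ))
      _ = C * θ ^ (m + 1) := by ring

theorem tendstoUniformlyOn_inv_pow_smul_zero {Λ μ : 𝕜} (hΛ : 1 < ‖Λ‖) (hμ : ‖μ‖ < ‖Λ‖)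
    (h0 : ∀ x ∈ S, ‖y 0 x‖ ≤ B) (hy : ∀ m, ∀ x ∈ S, ‖y (m + 1) x - μ • y m x‖ ≤ B) :
    TendstoUniformlyOn (fun m x => (Λ ^ m)⁻¹ • y m x) 0 atTop S := by
  obtain ⟨θ, hθ, hθΛ⟩ := exists_between (max_lt hμ hΛ)
  obtain ⟨hμθ, hθ1⟩ := max_lt_iff.1 hθ
  have : 0 ≤ θ := zero_le_one.trans hθ1.le
  have hΛ0 : 0 < ‖Λ‖ := one_pos.trans hΛ
  refine tendstoUniformlyOn_of_dist_le (ε := fun m => (B / (θ - ‖μ‖) + B) * (θ / ‖Λ‖) ^ m) ?_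
    fun m x hx => ?_
  · simpa using (tendsto_pow_atTop_nhds_zero_of_lt_one (by positivity)
      ((div_lt_one hΛ0).2 hθΛ)).const_mul (B / (θ - ‖μ‖) + B)
  · rw [Pi.zero_apply, dist_zero_right, norm_smul, norm_inv, norm_pow, div_pow, ← mul_div_assoc,
      inv_mul_eq_div]
    gcongr
    exact norm_le_mul_pow_of_norm_sub_smul_le (u := (y · x)) hθ1.le hμθ (h0 x hx) (hy · x hx) m

end LinearRecursion

theorem isTheta_one_of_sub_tendsto_zero {ι E : Type*} [NormedAddCommGroup E] {l : Filter ι}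
    {K : Set E} (hK : IsCompact K) (h0 : 0 ∉ K) {u v : ι → E} (hv : ∀ i, v i ∈ K)
    (huv : Tendsto (fun i => u i - v i) l (𝓝 0)) : u =Θ[l] fun _ => (1 : ℝ) := by
  obtain ⟨C, hC⟩ := hK.isBounded.exists_norm_le
  obtain ⟨δ, hδ, hball⟩ := Metric.isOpen_iff.1 hK.isClosed.isOpen_compl 0 h0
  have hδv : ∀ i, δ ≤ ‖v i‖ := fun i => not_lt.1 fun h => hball (by simpa using h) (hv i)
  have hvΘ : v =Θ[l] fun _ => (1 : ℝ) :=
    ⟨.of_bound C (.of_forall fun i => by simpa using hC _ (hv i)),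
      .of_bound δ⁻¹ (.of_forall fun i => by
        rw [norm_one, inv_mul_eq_div, one_le_div hδ]
        exact hδv i)⟩
  have huvo : (fun i => u i - v i) =o[l] v :=
    ((isLittleO_one_iff ℝ).2 huv).trans_isTheta hvΘ.symm
  have hu : u = v + fun i => u i - v i := by ext i; simp
  exact hu ▸ ((isTheta_refl v l).add_isLittleO huvo).trans hvΘ

theorem liminf_pos_and_limsup_lt_top_of_isTheta_one {ι : Type*} {l : Filter ι} {u : ι → ℝ}
    (hu0 : ∀ i, 0 ≤ u i) (hu : u =Θ[l] fun _ => (1 : ℝ)) :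
    0 < liminf (fun i => ENNReal.ofReal (u i)) l ∧
      limsup (fun i => ENNReal.ofReal (u i)) l < ⊤ := by
  obtain ⟨C, hC⟩ := hu.1.bound
  obtain ⟨c, hc, hcu⟩ := hu.2.exists_pos
  simp only [norm_one, mul_one, Real.norm_of_nonneg (hu0 _)] at hC
  have hcu' : ∀ᶠ i in l, c⁻¹ ≤ u i := by
    filter_upwards [hcu.bound] with i hi
    rw [norm_one, Real.norm_of_nonneg (hu0 i)] at hi
    exact (inv_le_iff_one_le_mul₀' hc).2 hi
  constructor
  · exact (ENNReal.ofReal_pos.2 (inv_pos.2 hc)).trans_le <| le_liminf_of_le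
      (by isBoundedDefault) (hcu'.mono fun i hi => ENNReal.ofReal_le_ofReal hi)
  · exact (limsup_le_of_le (by isBoundedDefault)
      (hC.mono fun i hi => ENNReal.ofReal_le_ofReal hi)).trans_lt ENNReal.ofReal_lt_top

theorem exists_floor_natCast_mul_eq {R : Type*} [Field R] [LinearOrder R] [IsStrictOrderedRing R]
    [FloorSemiring R] (q : ℕ) {Y : R} (hY : 0 ≤ Y) : ∃ c ≤ q, ⌊q * Y⌋₊ = q * ⌊Y⌋₊ + c := by
  have hlower : q * ⌊Y⌋₊ ≤ ⌊q * Y⌋₊ := by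
    refine Nat.le_floor ?_
    push_cast
    gcongr
    exact Nat.floor_le hY
  have hupper : ⌊q * Y⌋₊ ≤ q * (⌊Y⌋₊ + 1) := by
    refine Nat.floor_le_of_le ?_
    push_cast
    gcongr
    exact (Nat.lt_floor_add_one Y).le
  exact ⟨⌊q * Y⌋₊ - q * ⌊Y⌋₊, by lia, by lia⟩

theorem sum_zpow_pow_of_isPrimitiveRoot {K : Type*} [Field K] {w : K} {p : ℕ}
    (hw : IsPrimitiveRoot w p) (i : ℤ) :
    ∑ l ∈ range p, (w ^ i) ^ l = if (p : ℤ) ∣ i then (p : K) else 0 := by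
  split_ifs with hi
  · simp [(hw.zpow_eq_one_iff_dvd i).2 hi]
  · have hgeom := geom_sum_mul (w ^ i) p
    rw [← zpow_natCast, zpow_comm, zpow_natCast, hw.pow_eq_one, one_zpow, sub_self,
      mul_eq_zero] at hgeom
    exact hgeom.resolve_right (sub_ne_zero.2 (mt (hw.zpow_eq_one_iff_dvd i).1 hi))

theorem norm_geom_sum_le {𝕜 : Type*} [NormedField 𝕜] {z : 𝕜} (hz : ‖z‖ ≤ 1) (hz1 : z ≠ 1)
    (n : ℕ) : ‖∑ m ∈ range n, z ^ m‖ ≤ 2 / ‖z - 1‖ := by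
  rw [geom_sum_eq hz1, norm_div]
  gcongr
  refine (norm_sub_le _ _).trans ?_
  rw [norm_pow, norm_one, ← one_add_one_eq_two]
  gcongr
  exact pow_le_one₀ (norm_nonneg z) hz

theorem spectrum_eq_range_of_mul_eq_diagonal_mul {K n : Type*} [Field K] [Fintype n]
    [DecidableEq n] {V A : Matrix n n K} {d : n → K} (hV : IsUnit V)
    (h : V * A = Matrix.diagonal d * V) : spectrum K A = Set.range d := by
  obtain ⟨v, rfl⟩ := hV
  rw [← spectrum.units_conjugate (u := v), h, mul_assoc, Units.mul_inv, mul_one, spectrum_diagonal]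

theorem eta_zero : eta 0 = 1 := by simp [eta]

theorem eta_two_mul (n : ℕ) : eta (2 * n) = eta n := by
  rcases n.eq_zero_or_pos with rfl | hn
  · rfl
  · simp [eta, Nat.digits_def' one_lt_two (mul_pos two_pos hn)]

theorem eta_two_mul_add_one (n : ℕ) : eta (2 * n + 1) = -eta n := by
  rw [eta, eta, Nat.digits_add_two_add_one 0, List.sum_cons, pow_add]
  have hmod : (2 * n + 1) % 2 = 1 := by lia
  have hdiv : (2 * n + 1) / 2 = n := by lia
  simp [hmod, hdiv]

theorem eta_two_pow_mul_add {s c : ℕ} (hc : c < 2 ^ s) (N : ℕ) :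
    eta (2 ^ s * N + c) = eta N * eta c := by
  induction s generalizing c with
  | zero =>
    obtain rfl : c = 0 := by simpa using hc
    simp [eta_zero]
  | succ s ih =>
    rw [pow_succ'] at hc ⊢
    rw [mul_assoc]
    obtain ⟨d, rfl | rfl⟩ := c.even_or_odd'
    · rw [← mul_add, eta_two_mul, eta_two_mul, ih (by lia)]
    · rw [← add_assoc, ← mul_add, eta_two_mul_add_one, eta_two_mul_add_one, ih (by lia), mul_neg]

theorem eta_eq_one_or_neg_one (n : ℕ) : eta n = 1 ∨ eta n = -1 := neg_one_pow_eq_or ℤ _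

theorem norm_eta {R : Type*} [NormedRing R] [NormOneClass R] (n : ℕ) : ‖(eta n : R)‖ = 1 := by
  rcases eta_eq_one_or_neg_one n with h | h <;> simp [h]

/-- The Thue–Morse polynomial `∑_{m < n} η_m z^m`, the exponential sum of the sequence when `z` lies
on the unit circle. -/
def expSum {R : Type*} [Ring R] (z : R) (n : ℕ) : R := ∑ m ∈ range n, (eta m : R) * z ^ m

section Ring

variable {R : Type*} [CommRing R] (z : R)

theorem expSum_zero : expSum z 0 = 0 := sum_range_zero _

theorem expSum_succ (n : ℕ) : expSum z (n + 1) = expSum z n + eta n * z ^ n := sum_range_succ _ _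

theorem expSum_one : expSum z 1 = 1 := by simp [expSum, eta_zero]

theorem expSum_two_pow_mul_add {s c : ℕ} (hc : c ≤ 2 ^ s) (N : ℕ) :
    expSum z (2 ^ s * N + c) =
      expSum z (2 ^ s * N) + eta N * z ^ (2 ^ s * N) * expSum z c := by
  rw [expSum, sum_range_add, expSum, expSum, mul_sum]
  congr 1
  refine sum_congr rfl fun i hi => ?_
  rw [eta_two_pow_mul_add ((mem_range.1 hi).trans_le hc), pow_add]
  push_cast
  ring

theorem expSum_two_pow_mul (s N : ℕ) :
    expSum z (2 ^ s * N) = expSum z (2 ^ s) * expSum (z ^ 2 ^ s) N := by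
  induction N with
  | zero => simp [expSum_zero]
  | succ N ih =>
    rw [mul_add, mul_one, expSum_two_pow_mul_add z le_rfl, ih, expSum_succ, pow_mul]
    ring

theorem expSum_two_mul (N : ℕ) : expSum z (2 * N) = (1 - z) * expSum (z ^ 2) N := by
  have hone : eta 1 = -1 := by simpa [eta_zero] using eta_two_mul_add_one 0
  have htwo : expSum z 2 = 1 - z := by simp [expSum, sum_range_succ, eta_zero, hone, sub_eq_add_neg]
  simpa [htwo] using expSum_two_pow_mul z 1 N

theorem expSum_two_pow (s : ℕ) : expSum z (2 ^ s) = ∏ i ∈ range s, (1 - z ^ 2 ^ i) := by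
  induction s generalizing z with
  | zero => simp [expSum_one]
  | succ s ih =>
    rw [pow_succ', expSum_two_mul, ih, prod_range_succ', mul_comm, pow_zero, pow_one]
    simp only [← pow_mul, ← pow_succ']

end Ring

theorem norm_expSum_le {R : Type*} [NormedRing R] [NormOneClass R] {z : R} (hz : ‖z‖ ≤ 1) (n : ℕ) :
    ‖expSum z n‖ ≤ n := by
  have hterm : ∀ m ∈ range n, ‖(eta m : R) * z ^ m‖ ≤ 1 := fun m _ =>
    (norm_mul_le _ _).trans <| by
      rw [norm_eta, one_mul]
      exact (norm_pow_le z m).trans (pow_le_one₀ (norm_nonneg z) hz)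
  simpa [expSum] using norm_sum_le_of_le _ hterm

theorem orderTwo_pos {p : ℕ} (hp : Odd p) : 0 < orderTwo p := by
  have : NeZero p := ⟨hp.pos.ne'⟩
  have htwo : orderOf (ZMod.unitOfCoprime 2 (Nat.coprime_two_left.2 hp)) = orderTwo p := by
    rw [← orderOf_units, ZMod.coe_unitOfCoprime, Nat.cast_ofNat, orderTwo]
  exact htwo ▸ orderOf_pos _

theorem two_pow_orderTwo_mul_modEq_one (p r : ℕ) : 2 ^ (orderTwo p * r) ≡ 1 [MOD p] := by
  rw [← ZMod.natCast_eq_natCast_iff]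
  push_cast
  rw [pow_mul, orderTwo, pow_orderOf_eq_one, one_pow]

section RootOfUnity

variable {R : Type*} {p : ℕ}

theorem pow_two_pow_orderTwo_mul [Monoid R] {z : R} (hz : z ^ p = 1) (r : ℕ) :
    z ^ 2 ^ (orderTwo p * r) = z := by
  rw [pow_eq_pow_mod _ hz, two_pow_orderTwo_mul_modEq_one p r, ← pow_eq_pow_mod _ hz, pow_one]

theorem expSum_two_pow_orderTwo_mul [CommRing R] {z : R} (hz : z ^ p = 1) (r : ℕ) :
    expSum z (2 ^ (orderTwo p * r)) = expSum z (2 ^ orderTwo p) ^ r := by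
  induction r with
  | zero => simp [expSum_one]
  | succ r ih =>
    rw [mul_add, mul_one, pow_add, expSum_two_pow_mul, pow_two_pow_orderTwo_mul hz, ih, pow_succ]

theorem norm_expSum_two_pow_mul_add_sub_le [NormedField R] [NeZero p] {z : R} (hz : z ^ p = 1)
    (r N : ℕ) {c : ℕ} (hc : c ≤ 2 ^ (orderTwo p * r)) :
    ‖expSum z (2 ^ (orderTwo p * r) * N + c) - expSum z (2 ^ orderTwo p) ^ r * expSum z N‖ ≤
      2 ^ (orderTwo p * r) := by
  have hz1 : ‖z‖ = 1 := (isOfFinOrder_iff_pow_eq_one.2 ⟨p, NeZero.pos p, hz⟩).norm_eq_one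
  rw [expSum_two_pow_mul_add z hc, expSum_two_pow_mul, expSum_two_pow_orderTwo_mul hz,
    pow_two_pow_orderTwo_mul hz, add_sub_cancel_left, norm_mul, norm_mul, norm_eta, norm_pow, hz1,
    one_pow, one_mul, one_mul]
  exact (norm_expSum_le hz1.le c).trans (by exact_mod_cast hc)

theorem intModEq_sub_iff_eq_mod (m j : ℕ) (i : Fin p) :
    (m : ℤ) ≡ (i : ℤ) - j [ZMOD p] ↔ (i : ℕ) = (m + j) % p := by
  have hmod : (i : ℕ) = (m + j) % p ↔ m + j ≡ i [MOD p] := by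
    rw [Nat.ModEq, Nat.mod_eq_of_lt i.2, eq_comm]
  rw [hmod, ← Int.natCast_modEq_iff, Int.modEq_iff_dvd, Int.modEq_iff_dvd, Nat.cast_add, sub_sub,
    add_comm (j : ℤ)]

theorem sum_rarefiedSum_sub_mul_pow [CommRing R] [NeZero p] {z : R} (hz : z ^ p = 1) (j n : ℕ) :
    ∑ i : Fin p, (rarefiedSum p (i - j) n : R) * z ^ (i : ℕ) = z ^ j * expSum z n := by
  simp only [rarefiedSum, expSum, Int.cast_sum, sum_filter, sum_mul, mul_sum]
  rw [sum_comm]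
  refine sum_congr rfl fun m _ => ?_
  rw [Fintype.sum_eq_single ⟨(m + j) % p, Nat.mod_lt _ (NeZero.pos p)⟩]
  · rw [if_pos ((intModEq_sub_iff_eq_mod m j _).2 rfl), ← pow_eq_pow_mod _ hz]
    ring
  · intro i hi
    rw [if_neg fun h => hi (Fin.ext ((intModEq_sub_iff_eq_mod m j i).1 h)), Int.cast_zero, zero_mul]

theorem natCast_mul_rarefiedSum [Field R] [NeZero p] {w : R} (hw : IsPrimitiveRoot w p)
    (j n : ℕ) :
    (p : R) * rarefiedSum p j n = ∑ l ∈ range p, ((w ^ l)⁻¹) ^ j * expSum (w ^ l) n := by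
  simp only [rarefiedSum, expSum, Int.cast_sum, sum_filter, mul_sum]
  rw [sum_comm]
  refine sum_congr rfl fun m _ => ?_
  calc (p : R) * ((if (m : ℤ) ≡ j [ZMOD p] then eta m else 0 : ℤ) : R)
      = eta m * ∑ l ∈ range p, (w ^ ((m : ℤ) - j)) ^ l := by
        rw [sum_zpow_pow_of_isPrimitiveRoot hw]
        simp only [Int.modEq_comm (a := (m : ℤ)), Int.modEq_iff_dvd]
        split_ifs <;> simp [mul_comm]
    _ = ∑ l ∈ range p, ((w ^ l)⁻¹) ^ j * (eta m * (w ^ l) ^ m) := by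
        rw [mul_sum]
        refine sum_congr rfl fun l _ => ?_
        rw [zpow_sub₀ (hw.ne_zero (NeZero.ne p)), zpow_natCast, zpow_natCast, div_pow,
          pow_right_comm w m, pow_right_comm w j, inv_pow]
        ring

end RootOfUnity

theorem prod_expSum_pow_two_pow {R : Type*} [CommRing R] [IsDomain R] {n : ℕ} {w : R}
    (hw : IsPrimitiveRoot w (n + 1)) (hn : Odd (n + 1)) (s : ℕ) :
    ∏ l ∈ range n, expSum (w ^ (l + 1)) (2 ^ s) = (n + 1) ^ s := by
  simp only [expSum_two_pow]
  rw [Finset.prod_comm]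
  have hfactor : ∀ i ∈ range s, ∏ l ∈ range n, (1 - (w ^ (l + 1)) ^ 2 ^ i) = (n : R) + 1 := by
    intro i _
    have hwi := hw.pow_of_coprime _ ((Nat.coprime_two_left.2 hn).pow_left i)
    rw [← hwi.prod_one_sub_pow_eq_order]
    exact prod_congr rfl fun l _ => by rw [pow_right_comm]
  rw [prod_congr rfl hfactor, prod_const, card_range]

section Spectrum

variable {p : ℕ}

theorem spectrum_rarefactionMatrix [NeZero p] :
    spectrum ℂ (rarefactionMatrix p) =
      (fun z => expSum z (2 ^ orderTwo p)) '' {z : ℂ | z ^ p = 1} := by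
  obtain ⟨w, hw⟩ : ∃ w : ℂ, IsPrimitiveRoot w p := ⟨_, Complex.isPrimitiveRoot_exp p (NeZero.ne p)⟩
  have hwp (l : ℕ) : (w ^ l) ^ p = 1 := by rw [pow_right_comm, hw.pow_eq_one, one_pow]
  let v : Fin p → ℂ := fun l => w ^ (l : ℕ)
  have hv : Function.Injective v := fun l l' h => Fin.ext (hw.pow_inj l.2 l'.2 h)
  have hV : IsUnit (Matrix.vandermonde v) := (Matrix.isUnit_iff_isUnit_det _).2 <|
    isUnit_iff_ne_zero.2 (Matrix.det_vandermonde_ne_zero_iff.2 hv)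
  have hdiag : Matrix.vandermonde v * rarefactionMatrix p =
      Matrix.diagonal (fun l => expSum (v l) (2 ^ orderTwo p)) * Matrix.vandermonde v := by
    ext l j
    rw [Matrix.mul_apply, Matrix.diagonal_mul, Matrix.vandermonde_apply, mul_comm (expSum _ _),
      ← sum_rarefiedSum_sub_mul_pow (hwp l)]
    exact sum_congr rfl fun i _ => mul_comm _ _
  rw [spectrum_eq_range_of_mul_eq_diagonal_mul hV hdiag]
  refine Set.Subset.antisymm ?_ ?_
  · rintro _ ⟨l, rfl⟩
    exact ⟨w ^ (l : ℕ), hwp l, rfl⟩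
  · rintro _ ⟨z, hz, rfl⟩
    obtain ⟨l, hl, rfl⟩ := hw.eq_pow_of_pow_eq_one hz
    exact ⟨⟨l, hl⟩, rfl⟩

theorem isGreatest_lambdaOne [NeZero p] :
    IsGreatest ((fun z : ℂ => ‖expSum z (2 ^ orderTwo p)‖) '' {z | z ^ p = 1}) (lambdaOne p) := by
  have himage : (fun μ : ℂ => ‖μ‖) '' spectrum ℂ (rarefactionMatrix p) =
      (fun z : ℂ => ‖expSum z (2 ^ orderTwo p)‖) '' {z | z ^ p = 1} := by
    rw [spectrum_rarefactionMatrix, Set.image_image]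
  rw [lambdaOne, himage]
  have hfin := (Matrix.finite_spectrum (rarefactionMatrix p)).image fun μ : ℂ => ‖μ‖
  rw [himage] at hfin
  have hne : ((fun z : ℂ => ‖expSum z (2 ^ orderTwo p)‖) '' {z | z ^ p = 1}).Nonempty :=
    ⟨_, 1, one_pow p, rfl⟩
  exact ⟨hne.csSup_mem hfin, fun x hx => le_csSup hfin.bddAbove hx⟩

theorem norm_expSum_le_lambdaOne [NeZero p] {z : ℂ} (hz : z ^ p = 1) :
    ‖expSum z (2 ^ orderTwo p)‖ ≤ lambdaOne p :=
  isGreatest_lambdaOne.2 ⟨z, hz, rfl⟩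

theorem one_lt_lambdaOne (hp : Odd p) (hp3 : 3 ≤ p) : 1 < lambdaOne p := by
  -- The eigenvalues at the roots of unity other than `1` have product `p ^ s > 1`.
  by_contra! hle
  obtain ⟨n, rfl⟩ : ∃ n, p = n + 1 := ⟨p - 1, by lia⟩
  obtain ⟨w, hw⟩ : ∃ w : ℂ, IsPrimitiveRoot w (n + 1) :=
    ⟨_, Complex.isPrimitiveRoot_exp (n + 1) n.succ_ne_zero⟩
  have hfactor : ∀ l ∈ range n, ‖expSum (w ^ (l + 1)) (2 ^ orderTwo (n + 1))‖ ≤ 1 := fun l _ =>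
    (norm_expSum_le_lambdaOne (by rw [pow_right_comm, hw.pow_eq_one, one_pow])).trans hle
  have hprod : ‖((n : ℂ) + 1) ^ orderTwo (n + 1)‖ ≤ 1 := by
    rw [← prod_expSum_pow_two_pow hw hp, norm_prod]
    exact prod_le_one (fun _ _ => norm_nonneg _) hfactor
  have hn : 1 < ‖(n : ℂ) + 1‖ := by
    rw [← Nat.cast_succ, Complex.norm_natCast]
    exact_mod_cast (by lia : 1 < n + 1)
  rw [norm_pow] at hprod
  exact (one_lt_pow₀ hn (orderTwo_pos hp).ne').not_ge hprod

theorem norm_one_sub_lt_two (hp : Odd p) {z : ℂ} (hz : z ^ p = 1) : ‖1 - z‖ < 2 := by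
  have hz1 : ‖z‖ = 1 := Complex.norm_eq_one_of_pow_eq_one hz hp.pos.ne'
  have hadd : 0 < ‖1 + z‖ := by
    refine norm_pos_iff.2 fun h => ?_
    rw [← neg_eq_of_add_eq_zero_right h, hp.neg_one_pow] at hz
    norm_num at hz
  have hpar := parallelogram_law_with_norm ℝ (1 : ℂ) z
  rw [hz1, norm_one] at hpar
  nlinarith [norm_nonneg (1 - z)]

theorem lambdaOne_lt_two_pow (hp : Odd p) (hp3 : 3 ≤ p) : lambdaOne p < 2 ^ orderTwo p := by
  have := NeZero.of_pos hp.pos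
  obtain ⟨z, (hz : z ^ p = 1), hmax⟩ := (isGreatest_lambdaOne (p := p)).1
  have hpos : 0 < ‖expSum z (2 ^ orderTwo p)‖ :=
    one_pos.trans ((one_lt_lambdaOne hp hp3).trans_eq hmax.symm)
  rw [← hmax]
  simp only [expSum_two_pow, norm_prod] at hpos ⊢
  calc ∏ i ∈ range (orderTwo p), ‖1 - z ^ 2 ^ i‖ < ∏ _i ∈ range (orderTwo p), 2 := by
        refine prod_lt_prod_of_nonempty (fun i hi => ?_) (fun i _ => ?_)
          (nonempty_range_iff.2 (orderTwo_pos hp).ne')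
        · exact (norm_nonneg _).lt_of_ne' (prod_ne_zero_iff.1 hpos.ne' i hi)
        · refine norm_one_sub_lt_two hp ?_
          rw [pow_right_comm, hz, one_pow]
    _ = 2 ^ orderTwo p := by rw [prod_const, card_range]

theorem one_sub_pow_four_mul [NeZero p] {z : ℂ} (hz : z ^ p = 1) :
    (1 - z) ^ (4 * p) = (‖1 - z‖ : ℂ) ^ (4 * p) := by
  have hz1 : ‖z‖ = 1 := Complex.norm_eq_one_of_pow_eq_one hz (NeZero.ne p)
  have hconj : z * (starRingEnd ℂ) z = 1 := by simp [Complex.mul_conj', hz1]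
  have hsq : (1 - z) ^ 2 = (‖1 - z‖ : ℂ) ^ 2 * -z := by
    rw [← Complex.mul_conj', map_sub, map_one]
    linear_combination (z - 1) * hconj
  have hneg : (-z) ^ (2 * p) = 1 := by rw [pow_mul, neg_sq, pow_right_comm, hz, one_pow]
  rw [show 4 * p = 2 * (2 * p) by ring, pow_mul, hsq, mul_pow, hneg, mul_one, ← pow_mul]

theorem rIndex_mem [NeZero p] : 0 < rIndex p ∧ ∀ z ∈ spectrum ℂ (rarefactionMatrix p),
    ‖z‖ = lambdaOne p → z ^ rIndex p = (lambdaOne p : ℂ) ^ rIndex p := by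
  refine Nat.sInf_mem (s := {r : ℕ | 0 < r ∧ ∀ z ∈ spectrum ℂ (rarefactionMatrix p),
    ‖z‖ = lambdaOne p → z ^ r = (lambdaOne p : ℂ) ^ r})
    ⟨4 * p, mul_pos four_pos (NeZero.pos p), fun μ hμ hmax => ?_⟩
  rw [spectrum_rarefactionMatrix] at hμ
  obtain ⟨z, (hz : z ^ p = 1), rfl⟩ := hμ
  simp only [← hmax, expSum_two_pow, norm_prod, Complex.ofReal_prod, ← prod_pow]
  refine prod_congr rfl fun i _ => one_sub_pow_four_mul ?_
  rw [pow_right_comm, hz, one_pow]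

theorem rIndex_pos [NeZero p] : 0 < rIndex p := rIndex_mem.1

theorem expSum_pow_rIndex [NeZero p] {z : ℂ} (hz : z ^ p = 1)
    (hmax : ‖expSum z (2 ^ orderTwo p)‖ = lambdaOne p) :
    expSum z (2 ^ orderTwo p) ^ rIndex p = (lambdaOne p : ℂ) ^ rIndex p :=
  rIndex_mem.2 _ (by rw [spectrum_rarefactionMatrix]; exact ⟨z, hz, rfl⟩) hmax

theorem two_pow_orderTwo_rpow_beta (hp : Odd p) (hp3 : 3 ≤ p) :
    ((2 : ℝ) ^ orderTwo p) ^ beta p = lambdaOne p := by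
  have hs : (orderTwo p : ℝ) * Real.log 2 ≠ 0 :=
    mul_ne_zero (by exact_mod_cast (orderTwo_pos hp).ne') (Real.log_pos one_lt_two).ne'
  rw [Real.rpow_def_of_pos (by positivity), Real.log_pow, beta, mul_div_cancel₀ _ hs,
    Real.exp_log (one_pos.trans (one_lt_lambdaOne hp hp3))]

theorem beta_mem_Ioo (hp : Odd p) (hp3 : 3 ≤ p) : beta p ∈ Set.Ioo (0 : ℝ) 1 := by
  have hs : 0 < (orderTwo p : ℝ) * Real.log 2 :=
    mul_pos (by exact_mod_cast orderTwo_pos hp) (Real.log_pos one_lt_two)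
  have hlam := one_lt_lambdaOne hp hp3
  refine ⟨div_pos (Real.log_pos hlam) hs, (div_lt_one hs).2 ?_⟩
  rw [← Real.log_pow]
  exact Real.log_lt_log (one_pos.trans hlam) (lambdaOne_lt_two_pow hp hp3)

end Spectrum

theorem tendstoUniformlyOn_finset_sum {ι κ X E : Type*} [AddCommGroup E] [UniformSpace E]
    [IsUniformAddGroup E] {l : Filter ι} {S : Set X} {F : κ → ι → X → E} {G : κ → X → E}
    (s : Finset κ) (h : ∀ i ∈ s, TendstoUniformlyOn (F i) (G i) l S) :
    TendstoUniformlyOn (∑ i ∈ s, F i) (∑ i ∈ s, G i) l S := by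
  classical
  induction s using Finset.induction_on with
  | empty =>
    rw [sum_empty, sum_empty]
    exact tendsto_const_nhds.tendstoUniformlyOn_const S
  | insert i s hi ih =>
    rw [sum_insert hi, sum_insert hi]
    exact (h i (mem_insert_self i s)).add (ih fun j hj => h j (mem_insert_of_mem hj))

section Fractal

variable {p : ℕ}

theorem exists_tendstoUniformlyOn_expSum (hp : Odd p) (hp3 : 3 ≤ p) {z : ℂ} (hz : z ^ p = 1) :
    ∃ L : ℝ → ℂ, TendstoUniformlyOn
      (fun m X => (((lambdaOne p : ℂ) ^ rIndex p) ^ m)⁻¹ •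
        expSum z ⌊((2 : ℝ) ^ (orderTwo p * rIndex p)) ^ m * X⌋₊)
      L atTop (Set.Icc 0 (2 ^ (orderTwo p * rIndex p))) := by
  have := NeZero.of_pos hp.pos
  have hlam := one_lt_lambdaOne hp hp3
  have hnorm : ‖(lambdaOne p : ℂ) ^ rIndex p‖ = lambdaOne p ^ rIndex p := by
    rw [norm_pow, Complex.norm_real, Real.norm_of_nonneg (one_pos.trans hlam).le]
  have hΛ : 1 < ‖(lambdaOne p : ℂ) ^ rIndex p‖ := hnorm ▸ one_lt_pow₀ hlam rIndex_pos.ne'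
  have hrec : ∀ m : ℕ, ∀ X ∈ Set.Icc (0 : ℝ) (2 ^ (orderTwo p * rIndex p)),
      ‖expSum z ⌊((2 : ℝ) ^ (orderTwo p * rIndex p)) ^ (m + 1) * X⌋₊ -
        expSum z (2 ^ orderTwo p) ^ rIndex p •
          expSum z ⌊((2 : ℝ) ^ (orderTwo p * rIndex p)) ^ m * X⌋₊‖ ≤
        2 ^ (orderTwo p * rIndex p) := by
    intro m X hX
    obtain ⟨c, hc, hfloor⟩ := exists_floor_natCast_mul_eq (2 ^ (orderTwo p * rIndex p))
      (mul_nonneg (by positivity : (0 : ℝ) ≤ (2 ^ (orderTwo p * rIndex p)) ^ m) hX.1)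
    push_cast at hfloor
    rw [pow_succ', mul_assoc, hfloor]
    exact norm_expSum_two_pow_mul_add_sub_le hz _ _ hc
  rcases (norm_expSum_le_lambdaOne hz).eq_or_lt with hmax | hlt
  · rw [expSum_pow_rIndex hz hmax] at hrec
    exact exists_tendstoUniformlyOn_inv_pow_smul hΛ hrec
  · refine ⟨0, tendstoUniformlyOn_inv_pow_smul_zero hΛ ?_ (fun X hX => ?_) hrec⟩
    · rw [hnorm, norm_pow]
      exact pow_lt_pow_left₀ hlt (norm_nonneg _) rIndex_pos.ne'
    · rw [pow_zero, one_mul]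
      exact (norm_expSum_le (Complex.norm_eq_one_of_pow_eq_one hz (NeZero.ne p)).le _).trans
        ((Nat.floor_le hX.1).trans hX.2)

theorem exists_tendstoUniformlyOn_rarefiedSum (hp : Odd p) (hp3 : 3 ≤ p) (j : ℕ) :
    ∃ L : ℝ → ℝ, TendstoUniformlyOn
      (fun m X => (rarefiedSum p j ⌊((2 : ℝ) ^ (orderTwo p * rIndex p)) ^ m * X⌋₊ : ℝ) /
        (lambdaOne p ^ rIndex p) ^ m)
      L atTop (Set.Icc 0 (2 ^ (orderTwo p * rIndex p))) := by
  have := NeZero.of_pos hp.pos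
  obtain ⟨w, hw⟩ : ∃ w : ℂ, IsPrimitiveRoot w p := ⟨_, Complex.isPrimitiveRoot_exp p (NeZero.ne p)⟩
  choose L hL using fun l : ℕ => exists_tendstoUniformlyOn_expSum hp hp3 (z := w ^ l)
    (by rw [pow_right_comm, hw.pow_eq_one, one_pow])
  have hsum := (tendstoUniformlyOn_finset_sum (range p) fun l _ =>
    (uniformContinuous_const_smul ((p : ℂ)⁻¹ * ((w ^ l)⁻¹) ^ j)).comp_tendstoUniformlyOn (hL l)).re
  refine ⟨_, hsum.congr (.of_forall fun m X _ => ?_)⟩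
  have hinv : (rarefiedSum p j ⌊((2 : ℝ) ^ (orderTwo p * rIndex p)) ^ m * X⌋₊ : ℂ) =
      (p : ℂ)⁻¹ * ∑ l ∈ range p, ((w ^ l)⁻¹) ^ j *
        expSum (w ^ l) ⌊((2 : ℝ) ^ (orderTwo p * rIndex p)) ^ m * X⌋₊ := by
    rw [← natCast_mul_rarefiedSum hw, inv_mul_cancel_left₀ (NeZero.ne (p : ℂ))]
  refine Eq.trans (congrArg Complex.re ?_) (Complex.ofReal_re _)
  push_cast
  rw [hinv]
  simp only [Finset.sum_apply, Function.comp_apply, smul_eq_mul, mul_sum, sum_div]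
  refine sum_congr rfl fun l _ => ?_
  ring

/-- The point `X = 2^{r s x}` with `log X / (r s log 2) = x`, the variable in which the fractal
functions `ψ_{p,j}` have period `1`. -/
noncomputable def logScale (p : ℕ) (x : ℝ) : ℝ := 2 ^ ((rIndex p : ℝ) * (orderTwo p : ℝ) * x)

theorem logScale_add_natCast (x : ℝ) (m : ℕ) :
    logScale p (x + m) = ((2 : ℝ) ^ (orderTwo p * rIndex p)) ^ m * logScale p x := by
  rw [logScale, logScale, mul_add, Real.rpow_add two_pos, mul_comm, ← pow_mul, ← Real.rpow_natCast]
  push_cast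
  ring_nf

theorem one_le_logScale {x : ℝ} (hx : 0 ≤ x) : 1 ≤ logScale p x :=
  Real.one_le_rpow one_le_two (by positivity)

theorem logScale_le {x : ℝ} (hx : x ≤ 1) : logScale p x ≤ 2 ^ (orderTwo p * rIndex p) := by
  rw [← Real.rpow_natCast, Nat.cast_mul, mul_comm (orderTwo p : ℝ)]
  exact Real.rpow_le_rpow_of_exponent_le one_le_two (mul_le_of_le_one_right (by positivity) hx)

theorem logScale_log_div (hp : Odd p) {X : ℝ} (hX : 0 < X) :
    logScale p (Real.log X / ((rIndex p : ℝ) * (orderTwo p : ℝ) * Real.log 2)) = X := by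
  have := NeZero.of_pos hp.pos
  have hr : (rIndex p : ℝ) ≠ 0 := by exact_mod_cast rIndex_pos.ne'
  have hs : (orderTwo p : ℝ) ≠ 0 := by exact_mod_cast (orderTwo_pos hp).ne'
  have hlog : Real.log 2 ≠ 0 := (Real.log_pos one_lt_two).ne'
  rw [logScale, Real.rpow_def_of_pos two_pos]
  convert Real.exp_log hX using 2
  field_simp

theorem logScale_add_natCast_rpow_beta (hp : Odd p) (hp3 : 3 ≤ p) (x : ℝ) (m : ℕ) :
    logScale p (x + m) ^ beta p = (lambdaOne p ^ rIndex p) ^ m * logScale p x ^ beta p := by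
  rw [logScale_add_natCast, Real.mul_rpow (by positivity) (by unfold logScale; positivity),
    ← two_pow_orderTwo_rpow_beta hp hp3, Real.rpow_pow_comm (by positivity),
    Real.rpow_pow_comm (by positivity), pow_mul]

theorem tendstoUniformlyOn_psi (hp : Odd p) (hp3 : 3 ≤ p) (j : ℕ) :
    TendstoUniformlyOn
      (fun (m : ℕ) x => (rarefiedSum p j ⌊logScale p (x + m)⌋₊ : ℝ) / logScale p (x + m) ^ beta p)
      (psi p j) atTop (Set.Icc 0 1) := by
  obtain ⟨L, hL⟩ := exists_tendstoUniformlyOn_rarefiedSum hp hp3 j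
  have hunif : TendstoUniformlyOn
      (fun (m : ℕ) x => (rarefiedSum p j ⌊logScale p (x + m)⌋₊ : ℝ) / logScale p (x + m) ^ beta p)
      (fun x => L (logScale p x) / logScale p x ^ beta p) atTop (Set.Icc 0 1) := by
    refine Metric.tendstoUniformlyOn_iff.2 fun ε hε => ?_
    filter_upwards [Metric.tendstoUniformlyOn_iff.1 hL ε hε] with m hm x hx
    have hX := one_le_logScale (p := p) hx.1
    have hXβ : 1 ≤ logScale p x ^ beta p := Real.one_le_rpow hX (beta_mem_Ioo hp hp3).1.le
    rw [logScale_add_natCast_rpow_beta hp hp3, logScale_add_natCast, ← div_div, Real.dist_eq,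
      ← sub_div, abs_div, abs_of_pos (one_pos.trans_le hXβ)]
    exact (div_le_self (abs_nonneg _) hXβ).trans_lt
      (hm _ ⟨zero_le_one.trans hX, logScale_le hx.2⟩)
  exact hunif.congr_right fun x hx => (hunif.tendsto_at hx).limUnder_eq.symm

theorem abs_rarefiedSum_le (j : ℤ) (n : ℕ) : |(rarefiedSum p j n : ℝ)| ≤ n := by
  rw [rarefiedSum, Int.cast_sum]
  refine (abs_sum_le_sum_abs _ _).trans ?_
  simp only [← Real.norm_eq_abs, norm_eta, sum_const, nsmul_eq_mul, mul_one]
  exact_mod_cast (card_filter_le _ _).trans (card_range n).le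

theorem isBounded_psi_image_Icc (hp : Odd p) (hp3 : 3 ≤ p) (j : ℕ) :
    Bornology.IsBounded (psi p j '' Set.Icc 0 1) := by
  obtain ⟨m, hm⟩ := (Metric.tendstoUniformlyOn_iff.1 (tendstoUniformlyOn_psi hp hp3 j) 1
    one_pos).exists
  refine isBounded_iff_forall_norm_le.2
    ⟨1 + (2 ^ (orderTwo p * rIndex p)) ^ m * 2 ^ (orderTwo p * rIndex p), ?_⟩
  rintro _ ⟨x, hx, rfl⟩
  have hX : 1 ≤ logScale p (x + m) := one_le_logScale (add_nonneg hx.1 m.cast_nonneg)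
  have hXβ : 1 ≤ logScale p (x + m) ^ beta p := Real.one_le_rpow hX (beta_mem_Ioo hp hp3).1.le
  have hratio : ‖(rarefiedSum p j ⌊logScale p (x + m)⌋₊ : ℝ) / logScale p (x + m) ^ beta p‖ ≤
      logScale p (x + m) := by
    rw [Real.norm_eq_abs, abs_div, abs_of_pos (one_pos.trans_le hXβ)]
    exact (div_le_self (abs_nonneg _) hXβ).trans
      ((abs_rarefiedSum_le _ _).trans (Nat.floor_le (zero_le_one.trans hX)))
  refine (norm_le_norm_sub_add _ _).trans (add_le_add (hm x hx).le (hratio.trans ?_))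
  rw [logScale_add_natCast]
  gcongr
  exact logScale_le hx.2

theorem tendsto_rarefiedSum_div_rpow_beta_sub_psi (hp : Odd p) (hp3 : 3 ≤ p) (j : ℕ) :
    Tendsto (fun n : ℕ => (rarefiedSum p j n : ℝ) / (n : ℝ) ^ beta p -
      psi p j (Int.fract (Real.log n / ((rIndex p : ℝ) * (orderTwo p : ℝ) * Real.log 2))))
      atTop (𝓝 0) := by
  have := NeZero.of_pos hp.pos
  have hperiod : 0 < (rIndex p : ℝ) * orderTwo p * Real.log 2 :=
    mul_pos (mul_pos (by exact_mod_cast rIndex_pos) (by exact_mod_cast orderTwo_pos hp))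
      (Real.log_pos one_lt_two)
  have hlog : Tendsto (fun n : ℕ => Real.log n / ((rIndex p : ℝ) * orderTwo p * Real.log 2))
      atTop atTop :=
    (Real.tendsto_log_atTop.comp tendsto_natCast_atTop_atTop).atTop_div_const hperiod
  refine Metric.tendsto_nhds.2 fun ε hε => ?_
  filter_upwards [(tendsto_nat_floor_atTop.comp hlog).eventually
    (Metric.tendstoUniformlyOn_iff.1 (tendstoUniformlyOn_psi hp hp3 j) ε hε),
    eventually_ge_atTop 1] with n hn hn1
  have hx0 : 0 ≤ Real.log n / ((rIndex p : ℝ) * orderTwo p * Real.log 2) :=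
    div_nonneg (Real.log_natCast_nonneg n) hperiod.le
  have hdist := hn _ ⟨Int.fract_nonneg _, (Int.fract_lt_one
    (Real.log n / ((rIndex p : ℝ) * (orderTwo p : ℝ) * Real.log 2))).le⟩
  rw [Function.comp_apply, natCast_floor_eq_intCast_floor hx0, Int.fract_add_floor,
    logScale_log_div hp (by exact_mod_cast hn1), Nat.floor_natCast] at hdist
  rwa [dist_zero_right, ← dist_eq_norm, dist_comm]

end Fractal

section RarefactionDomain

variable {p : ℕ}

/-- The `p`-th root of unity `ξ = e^{-2πi t/p}` that defines the rarefaction domain. -/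
noncomputable def xi (p : ℕ) (t : ℤ) : ℂ :=
  Complex.exp (-(2 * (Real.pi : ℂ) * Complex.I * (t : ℂ) / (p : ℂ)))

theorem xi_pow [NeZero p] (t : ℤ) : xi p t ^ p = 1 := by
  have hp : (p : ℂ) ≠ 0 := NeZero.ne _
  rw [xi, ← Complex.exp_nat_mul, Complex.exp_eq_one_iff]
  exact ⟨-t, by push_cast; field_simp⟩

theorem isCompact_rarefactionDomain (p : ℕ) (t : ℤ) : IsCompact (rarefactionDomain p t) := by
  have hbox : IsCompact (Set.univ.pi fun j : Fin p =>
      Set.Icc (sInf (psi p j '' Set.Icc 0 1)) (sSup (psi p j '' Set.Icc 0 1))) :=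
    isCompact_univ_pi fun _ => isCompact_Icc
  have hcont : Continuous fun y : Fin p → ℝ => ∑ j : Fin p, (y j : ℂ) * xi p t ^ (j : ℕ) := by
    fun_prop
  convert hbox.image hcont using 1
  ext z
  simp only [rarefactionDomain, xi, Set.mem_ofPred_eq, Set.mem_image, Set.mem_univ_pi, eq_comm]

theorem sum_psi_mul_xi_pow_mem_rarefactionDomain (hp : Odd p) (hp3 : 3 ≤ p) (t : ℤ) {x : ℝ}
    (hx : x ∈ Set.Icc (0 : ℝ) 1) :
    ∑ j : Fin p, (psi p j x : ℂ) * xi p t ^ (j : ℕ) ∈ rarefactionDomain p t := by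
  refine ⟨fun j => psi p j x, fun j => ?_, rfl⟩
  have hmem : psi p j x ∈ psi p j '' Set.Icc 0 1 := ⟨x, hx, rfl⟩
  have hbdd := isBounded_psi_image_Icc hp hp3 j
  exact ⟨csInf_le hbdd.bddBelow hmem, le_csSup hbdd.bddAbove hmem⟩

theorem isTheta_expSum_xi (hp : Odd p) (hp3 : 3 ≤ p) {t : ℤ}
    (hR : (0 : ℂ) ∉ rarefactionDomain p t) :
    (fun n : ℕ => expSum (xi p t) n) =Θ[atTop] fun n : ℕ => (n : ℝ) ^ beta p := by
  have := NeZero.of_pos hp.pos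
  set x : ℕ → ℝ := fun n =>
    Int.fract (Real.log n / ((rIndex p : ℝ) * (orderTwo p : ℝ) * Real.log 2))
  have hmem (n : ℕ) := sum_psi_mul_xi_pow_mem_rarefactionDomain hp hp3 t (x := x n)
    ⟨Int.fract_nonneg _, (Int.fract_lt_one _).le⟩
  have hexpand (n : ℕ) : expSum (xi p t) n / ((n : ℝ) ^ beta p : ℝ) =
      ∑ j : Fin p, ((rarefiedSum p (j : ℕ) n / (n : ℝ) ^ beta p : ℝ) : ℂ) * xi p t ^ (j : ℕ) := by
    have hsum := sum_rarefiedSum_sub_mul_pow (xi_pow (p := p) t) 0 n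
    rw [pow_zero, one_mul] at hsum
    rw [← hsum, sum_div]
    refine sum_congr rfl fun j _ => ?_
    push_cast
    rw [sub_zero, div_mul_eq_mul_div]
  have hsub : Tendsto (fun n : ℕ => expSum (xi p t) n / ((n : ℝ) ^ beta p : ℝ) -
      ∑ j : Fin p, (psi p j (x n) : ℂ) * xi p t ^ (j : ℕ)) atTop (𝓝 0) := by
    simp only [hexpand, ← sum_sub_distrib, ← sub_mul, ← Complex.ofReal_sub]
    simpa using tendsto_finsetSum univ fun (j : Fin p) _ =>
      ((Complex.continuous_ofReal.tendsto 0).comp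
        (tendsto_rarefiedSum_div_rpow_beta_sub_psi hp hp3 j)).mul_const (xi p t ^ (j : ℕ))
  have hratio := isTheta_one_of_sub_tendsto_zero (isCompact_rarefactionDomain p t) hR hmem hsub
  have hmul := hratio.mul
    (Complex.isTheta_ofReal (fun n : ℕ => (n : ℝ) ^ beta p) atTop)
  refine IsTheta.trans (EventuallyEq.isTheta ?_) (by simpa using hmul)
  filter_upwards [eventually_ge_atTop 1] with n hn
  have hn0 : (n : ℝ) ^ beta p ≠ 0 := (Real.rpow_pos_of_pos (by exact_mod_cast hn) _).ne'
  rw [div_mul_cancel₀ _ (Complex.ofReal_ne_zero.2 hn0)]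

end RarefactionDomain

section Chain

variable {a b k : ℝ}

theorem f_natCast (a b : ℝ) (n : ℕ) :
    f a b n = ∑ m ∈ range n, ((a + b) / 2 + (a - b) / 2 * (eta m : ℝ)) := by
  rcases n.eq_zero_or_pos with rfl | hn
  · simp [f]
  · simp [f, Int.sign_eq_one_of_pos (Nat.cast_pos.2 hn)]

theorem f_natCast_succ (a b : ℝ) (n : ℕ) :
    f a b (n + 1 : ℕ) = f a b n + ((a + b) / 2 + (a - b) / 2 * (eta n : ℝ)) := by
  rw [f_natCast, f_natCast, sum_range_succ]

theorem f_natCast_two_mul (a b : ℝ) (m : ℕ) : f a b (2 * m : ℕ) = (a + b) * m := by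
  induction m with
  | zero => simp [f]
  | succ m ih =>
    rw [mul_add_one, ← one_add_one_eq_two, ← add_assoc, one_add_one_eq_two, f_natCast_succ,
      f_natCast_succ, ih, eta_two_mul, eta_two_mul_add_one]
    push_cast
    ring

/-- The structure factor `∑_{1 ≤ i ≤ n} e^{-i k f(i)}` of the first `n` points. -/
noncomputable def structureFactor (a b k : ℝ) (n : ℕ) : ℂ :=
  ∑ i ∈ range n, Complex.exp (-(Complex.I * (k : ℂ) * (f a b (i + 1 : ℕ) : ℂ)))

/-- The phase `e^{-i k (a+b)/2}` acquired over one spacing of mean length. -/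
noncomputable def meanPhase (a b k : ℝ) : ℂ :=
  Complex.exp (-(Complex.I * (k : ℂ) * (((a + b) / 2 : ℝ) : ℂ)))

theorem norm_exp_neg_I_mul (x y : ℝ) : ‖Complex.exp (-(Complex.I * (x : ℂ) * (y : ℂ)))‖ = 1 := by
  rw [Complex.norm_exp]
  simp

theorem exp_f_natCast_two_mul (a b k : ℝ) (m : ℕ) :
    Complex.exp (-(Complex.I * (k : ℂ) * (f a b (2 * m : ℕ) : ℂ))) =
      (meanPhase a b k ^ 2) ^ m := by
  rw [← pow_mul, meanPhase, ← Complex.exp_nat_mul, f_natCast_two_mul]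
  push_cast
  ring_nf

theorem exp_f_natCast_succ (a b k : ℝ) (n : ℕ) :
    Complex.exp (-(Complex.I * (k : ℂ) * (f a b (n + 1 : ℕ) : ℂ))) =
      Complex.exp (-(Complex.I * (k : ℂ) * (f a b n : ℂ))) * (meanPhase a b k *
        (Real.cos (k * (a - b) / 2) - Complex.I * Real.sin (k * (a - b) / 2) * eta n)) := by
  have hphase : (Real.cos (k * (a - b) / 2) - Complex.I * Real.sin (k * (a - b) / 2) * eta n : ℂ) =
      Complex.exp (-(eta n * (k * (a - b) / 2 : ℝ)) * Complex.I) := by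
    rcases eta_eq_one_or_neg_one n with h | h <;> rw [h, Complex.exp_mul_I] <;> push_cast <;>
      simp only [one_mul, neg_one_mul, neg_neg, Complex.cos_neg, Complex.sin_neg] <;> ring
  rw [hphase, meanPhase, ← Complex.exp_add, ← Complex.exp_add, f_natCast_succ]
  push_cast
  ring_nf

theorem structureFactor_two_mul (a b k : ℝ) (M : ℕ) :
    structureFactor a b k (2 * M) =
      (meanPhase a b k * Real.cos (k * (a - b) / 2) + meanPhase a b k ^ 2) *
        ∑ m ∈ range M, (meanPhase a b k ^ 2) ^ m -
      Complex.I * meanPhase a b k * Real.sin (k * (a - b) / 2) *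
        expSum (meanPhase a b k ^ 2) M := by
  induction M with
  | zero => simp [structureFactor, expSum_zero]
  | succ M ih =>
    have hlast : Complex.exp (-(Complex.I * (k : ℂ) * (f a b (2 * M + 1 + 1 : ℕ) : ℂ))) =
        (meanPhase a b k ^ 2) ^ (M + 1) := exp_f_natCast_two_mul a b k (M + 1)
    rw [structureFactor, mul_add_one, ← one_add_one_eq_two, ← add_assoc, one_add_one_eq_two,
      sum_range_succ, sum_range_succ, ← structureFactor, ih, hlast, exp_f_natCast_succ,
      exp_f_natCast_two_mul, eta_two_mul, sum_range_succ, expSum_succ]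
    ring

theorem norm_meanPhase (a b k : ℝ) : ‖meanPhase a b k‖ = 1 := norm_exp_neg_I_mul _ _

theorem structureFactor_two_mul_sub_expSum (hξ : meanPhase a b k ≠ 1) (M : ℕ) :
    structureFactor a b k (2 * M) -
      -Complex.I * meanPhase a b k * Real.sin (k * (a - b) / 2) / (1 - meanPhase a b k) *
        expSum (meanPhase a b k) (2 * M) =
      (meanPhase a b k * Real.cos (k * (a - b) / 2) + meanPhase a b k ^ 2) *
        ∑ m ∈ range M, (meanPhase a b k ^ 2) ^ m := by
  rw [structureFactor_two_mul, expSum_two_mul, ← mul_assoc,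
    div_mul_cancel₀ _ (sub_ne_zero.2 hξ.symm)]
  ring

theorem norm_structureFactor_sub_expSum_succ_sub_le (c : ℂ) (n : ℕ) :
    ‖(structureFactor a b k (n + 1) - c * expSum (meanPhase a b k) (n + 1)) -
      (structureFactor a b k n - c * expSum (meanPhase a b k) n)‖ ≤ 1 + ‖c‖ := by
  rw [structureFactor, sum_range_succ, ← structureFactor, expSum_succ, mul_add, add_sub_add_comm,
    add_sub_cancel_left]
  refine (norm_sub_le _ _).trans_eq ?_
  rw [norm_exp_neg_I_mul, norm_mul, norm_mul, norm_eta, norm_pow, norm_meanPhase, one_pow, mul_one,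
    mul_one]

theorem isBigO_structureFactor_sub_expSum (hξ : meanPhase a b k ^ 2 ≠ 1) :
    (fun n => structureFactor a b k n -
      -Complex.I * meanPhase a b k * Real.sin (k * (a - b) / 2) / (1 - meanPhase a b k) *
        expSum (meanPhase a b k) n) =O[atTop] fun _ => (1 : ℝ) := by
  have hξ1 : meanPhase a b k ≠ 1 := fun h => hξ (by rw [h, one_pow])
  have heven := structureFactor_two_mul_sub_expSum hξ1
  set ξ := meanPhase a b k
  set c := -Complex.I * ξ * Real.sin (k * (a - b) / 2) / (1 - ξ)
  set A := ξ * Real.cos (k * (a - b) / 2) + ξ ^ 2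
  have hnorm : ‖ξ ^ 2‖ ≤ 1 := by rw [norm_pow, norm_meanPhase, one_pow]
  have heven_le (M : ℕ) : ‖structureFactor a b k (2 * M) - c * expSum ξ (2 * M)‖ ≤
      ‖A‖ * (2 / ‖ξ ^ 2 - 1‖) := by
    rw [heven, norm_mul]
    gcongr
    exact norm_geom_sum_le hnorm hξ M
  refine .of_bound (‖A‖ * (2 / ‖ξ ^ 2 - 1‖) + (1 + ‖c‖)) (.of_forall fun n => ?_)
  rw [norm_one, mul_one]
  obtain ⟨M, rfl | rfl⟩ := n.even_or_odd'
  · exact (heven_le M).trans (le_add_of_nonneg_right (by positivity))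
  · exact (norm_le_insert' _ _).trans
      (add_le_add (heven_le M) (norm_structureFactor_sub_expSum_succ_sub_le c _))

theorem fourierCoefficient_eq_zero (hsin : Real.sin (k * (a - b) / 2) = 0) {m : ℤ}
    (hm : Odd m) : fourierCoefficient a b m k = 0 := by
  -- On `[0, 1)` the integrand is `e^{-2πi(2q + m)x}`, and `2q + m` is odd, hence nonzero.
  obtain ⟨q, hq⟩ := Real.sin_eq_zero_iff.1 hsin
  have hk : (k : ℂ) * ((2 * (a - b) : ℝ) : ℂ) = 4 * q * Real.pi := by
    have : k * (2 * (a - b)) = 4 * q * Real.pi := by linarith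
    exact_mod_cast this
  have hfreq : ((2 * q + m : ℤ) : ℂ) ≠ 0 := by
    obtain ⟨d, rfl⟩ := hm
    exact_mod_cast (by lia : 2 * q + (2 * d + 1) ≠ 0)
  have hintegrand : ∀ x : ℝ,
      Complex.exp (-(Complex.I * (k : ℂ) * ((2 * (a - b) : ℝ) : ℂ) * ((Int.fract x : ℝ) : ℂ))) *
        Complex.exp (-(2 * (Real.pi : ℂ) * Complex.I * (m : ℂ) * (x : ℂ))) =
      Complex.exp (-(2 * Real.pi * Complex.I * ((2 * q + m : ℤ) : ℂ)) * x) := by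
    intro x
    rw [← Complex.exp_add, Complex.exp_eq_exp_iff_exists_int]
    refine ⟨2 * q * ⌊x⌋, ?_⟩
    rw [mul_assoc Complex.I, hk, Int.fract]
    push_cast
    ring
  have hne : -(2 * Real.pi * Complex.I * ((2 * q + m : ℤ) : ℂ)) ≠ 0 :=
    neg_ne_zero.2 (mul_ne_zero Complex.two_pi_I_ne_zero hfreq)
  simp only [fourierCoefficient, hintegrand]
  rw [integral_exp_mul_complex hne, div_eq_zero_iff, sub_eq_zero,
    Complex.exp_eq_exp_iff_exists_int]
  exact .inl ⟨-(2 * q + m), by push_cast; ring⟩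

theorem sin_ne_zero_of_kappaEta_ne_zero (hκ : kappaEta a b k ≠ 0) :
    Real.sin (k * (a - b) / 2) ≠ 0 := fun hsin =>
  hκ <| Tendsto.limUnder_eq <| tendsto_const_nhds.congr fun _ =>
    (sum_eq_zero fun _ hm => fourierCoefficient_eq_zero hsin (mem_filter.1 hm).2).symm

theorem meanPhase_eq_xi (hab : a + b ≠ 0) {t : ℤ} {p : ℕ}
    (hk : k = 4 * Real.pi / (a + b) * ((t : ℝ) / (p : ℝ))) : meanPhase a b k = xi p t := by
  have hmean : k * ((a + b) / 2) = 2 * Real.pi * t / p := by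
    rw [hk]
    field_simp
    ring
  rw [meanPhase, xi, mul_assoc, ← Complex.ofReal_mul, hmean]
  push_cast
  ring_nf

theorem xi_ne_one {p : ℕ} (hp : Odd p) (hp3 : 3 ≤ p) {t : ℤ}
    (hR : (0 : ℂ) ∉ rarefactionDomain p t) : xi p t ≠ 1 := by
  intro hxi
  obtain ⟨n, hn⟩ := eventually_atTop.1 (isTheta_expSum_xi hp hp3 hR).2.eq_zero_imp
  have hrpow := hn (2 * (n + 1)) (by lia) (by rw [hxi, expSum_two_mul, sub_self, zero_mul])
  exact (Real.rpow_pos_of_pos (by positivity) (beta p)).ne' hrpow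

theorem xi_sq_ne_one {p : ℕ} (hp : Odd p) {t : ℤ} (hξ : xi p t ≠ 1) : xi p t ^ 2 ≠ 1 := by
  have := NeZero.of_pos hp.pos
  refine fun hsq => hξ ?_
  obtain ⟨q, hq⟩ := hp
  have hpow := congrArg (xi p t ^ ·) hq
  simpa [xi_pow, pow_add, pow_mul, hsq] using hpow.symm

theorem isTheta_structureFactor (hab : a + b ≠ 0) {t : ℤ} {p : ℕ} (hp : Odd p) (hp3 : 3 ≤ p)
    (hk : k = 4 * Real.pi / (a + b) * ((t : ℝ) / (p : ℝ))) (hκ : kappaEta a b k ≠ 0)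
    (hR : (0 : ℂ) ∉ rarefactionDomain p t) :
    (fun n => structureFactor a b k n) =Θ[atTop] fun n : ℕ => (n : ℝ) ^ beta p := by
  have hξ : meanPhase a b k = xi p t := meanPhase_eq_xi hab hk
  have hξ1 := xi_ne_one hp hp3 hR
  have hO := isBigO_structureFactor_sub_expSum (hξ ▸ xi_sq_ne_one hp hξ1)
  rw [hξ] at hO
  have hc : -Complex.I * xi p t * Real.sin (k * (a - b) / 2) / (1 - xi p t) ≠ 0 :=
    div_ne_zero (mul_ne_zero (mul_ne_zero (neg_ne_zero.2 Complex.I_ne_zero) (Complex.exp_ne_zero _))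
      (Complex.ofReal_ne_zero.2 (sin_ne_zero_of_kappaEta_ne_zero hκ))) (sub_ne_zero.2 hξ1.symm)
  have hmain := (isTheta_const_mul_left hc).2 (isTheta_expSum_xi hp hp3 hR)
  have hone : (fun _ => (1 : ℝ)) =o[atTop] fun n : ℕ => (n : ℝ) ^ beta p :=
    (isLittleO_const_left.2 <| .inr <| tendsto_norm_atTop_atTop.comp <|
      (tendsto_rpow_atTop (beta_mem_Ioo hp hp3).1).comp tendsto_natCast_atTop_atTop)
  exact (EventuallyEq.isTheta (.of_forall fun _ => (add_sub_cancel _ _).symm)).trans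
    (hmain.add_isLittleO (hO.trans_isLittleO hone))

end Chain

theorem exists_forall_le_iff_le {α : Type*} [LinearOrder α] [NoMaxOrder α] {u : ℕ → α}
    (hu : Monotone u) (hlim : Tendsto u atTop atTop) {y : α} (hy : u 0 ≤ y) :
    ∃ N, ∀ n, u n ≤ y ↔ n ≤ N := by
  classical
  have hex : ∃ n, y < u n := (hlim.eventually_gt_atTop y).exists
  obtain ⟨N, hN⟩ := Nat.exists_eq_add_one_of_ne_zero fun h => ((Nat.find_eq_zero hex).1 h).not_ge hy
  refine ⟨N, fun n => ?_⟩
  rw [← Nat.lt_succ_iff, Nat.succ_eq_add_one, ← hN, Nat.lt_find_iff]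
  exact ⟨fun h m hm => not_lt.2 ((hu hm).trans h), fun h => not_lt.1 (h n le_rfl)⟩

section Approximants

variable {a b : ℝ} (ha : 0 < a) (hb : 0 < b)

include ha hb

theorem step_pos (n : ℕ) : 0 < (a + b) / 2 + (a - b) / 2 * (eta n : ℝ) := by
  rcases eta_eq_one_or_neg_one n with h | h <;> rw [h] <;> push_cast <;> linarith

theorem strictMono_f_natCast : StrictMono fun n : ℕ => f a b n :=
  strictMono_nat_of_lt_succ fun n => by
    rw [f_natCast_succ]
    exact lt_add_of_pos_right _ (step_pos ha hb n)

theorem tendsto_f_natCast_atTop : Tendsto (fun n : ℕ => f a b n) atTop atTop := by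
  refine tendsto_atTop_atTop_of_monotone (strictMono_f_natCast ha hb).monotone fun y => ?_
  obtain ⟨m, hm⟩ := exists_nat_ge (y / (a + b))
  exact ⟨2 * m, (div_le_iff₀' (add_pos ha hb)).1 hm |>.trans_eq (f_natCast_two_mul a b m).symm⟩

theorem f_pos_iff (n : ℤ) : 0 < f a b n ↔ 1 ≤ n := by
  have hsum : 0 ≤ ∑ m ∈ range n.natAbs, ((a + b) / 2 + (a - b) / 2 * (eta m : ℝ)) :=
    sum_nonneg fun m _ => (step_pos ha hb m).le
  refine ⟨fun h => ?_, fun h => ?_⟩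
  · exact Int.sign_pos_iff.1 (by exact_mod_cast pos_of_mul_pos_left h hsum)
  · obtain ⟨m, rfl⟩ := Int.eq_ofNat_of_zero_le (zero_le_one.trans h)
    simpa [f] using strictMono_f_natCast ha hb (show 0 < m by lia)

theorem f_mem_approximant_iff (U : AveragingSequence) (l : ℕ) (n : ℤ) :
    f a b n ∈ U.approximant a b l ↔ 1 ≤ n ∧ f a b n ≤ U.ρ l * U.hi := by
  have hρ := U.ρ_pos l
  constructor
  · rintro ⟨⟨x, hx, hxn⟩, m, hm, hmn⟩
    have hm1 : 1 ≤ m := by_contra fun h => hm (if_neg h)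
    rw [← f_pos_iff ha hb, ← hmn, f_pos_iff ha hb]
    refine ⟨hm1, ?_⟩
    rw [hmn, ← hxn]
    exact mul_le_mul_of_nonneg_left hx.2 hρ.le
  · rintro ⟨hn, hle⟩
    refine ⟨⟨f a b n / U.ρ l, ⟨?_, (div_le_iff₀' hρ).2 hle⟩, mul_div_cancel₀ _ hρ.ne'⟩, n,
      by simp [weight, hn], rfl⟩
    exact U.lo_neg.le.trans (div_nonneg ((f_pos_iff ha hb n).2 hn).le hρ.le)

theorem f_preimage_approximant (U : AveragingSequence) (l : ℕ) :
    f a b ⁻¹' U.approximant a b l =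
      (fun i : ℕ => ((i + 1 : ℕ) : ℤ)) '' (range (U.approximant a b l).ncard : Set ℕ) := by
  obtain ⟨N, hN⟩ := exists_forall_le_iff_le (strictMono_f_natCast ha hb).monotone
    (tendsto_f_natCast_atTop ha hb) (y := U.ρ l * U.hi)
    (by simpa [f] using (mul_pos (U.ρ_pos l) U.hi_pos).le)
  have hpre : f a b ⁻¹' U.approximant a b l =
      (fun i : ℕ => ((i + 1 : ℕ) : ℤ)) '' (range N : Set ℕ) := by
    ext n
    rw [Set.mem_preimage, f_mem_approximant_iff ha hb]
    constructor
    · rintro ⟨hn, hle⟩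
      obtain ⟨i, rfl⟩ := Int.eq_ofNat_of_zero_le (zero_le_one.trans hn)
      have := (hN i).1 hle
      exact ⟨i - 1, mem_coe.2 (mem_range.2 (by lia)), by lia⟩
    · rintro ⟨i, hi, rfl⟩
      exact ⟨by lia, (hN _).2 (mem_range.1 hi)⟩
  have himage : f a b '' (f a b ⁻¹' U.approximant a b l) = U.approximant a b l :=
    Set.image_preimage_eq_of_subset fun _ hx => Set.image_subset_range _ _ hx.2
  have hcard : (U.approximant a b l).ncard = N := by
    have hinj : Function.Injective fun i : ℕ => f a b (i + 1 : ℕ) :=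
      (strictMono_f_natCast ha hb).injective.comp (add_left_injective 1)
    rw [← himage, hpre, Set.image_image, Set.ncard_image_of_injective _ hinj,
      Set.ncard_coe_finset, card_range]
  rw [hpre, hcard]

theorem tendsto_ncard_approximant (U : AveragingSequence) :
    Tendsto (fun l => (U.approximant a b l).ncard) atTop atTop := by
  refine tendsto_atTop.2 fun n => ?_
  filter_upwards [(U.ρ_tendsto.atTop_mul_const U.hi_pos).eventually_ge_atTop
    (f a b (n + 1 : ℕ))] with l hl
  have hmem : ((n + 1 : ℕ) : ℤ) ∈ f a b ⁻¹' U.approximant a b l :=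
    (f_mem_approximant_iff ha hb U l _).2 ⟨by lia, hl⟩
  rw [f_preimage_approximant ha hb] at hmem
  obtain ⟨i, hi, hin⟩ := hmem
  have := mem_range.1 hi
  lia

theorem nu_eq_structureFactor (U : AveragingSequence) (l : ℕ) (k : ℝ) :
    nu a b U l k = 1 / ((U.approximant a b l).ncard : ℝ) *
      ‖structureFactor a b k (U.approximant a b l).ncard‖ ^ 2 := by
  have hsum : ∑ᶠ (n : ℤ) (_ : n ∈ f a b ⁻¹' U.approximant a b l),
      weight n * Complex.exp (-(Complex.I * (k : ℂ) * (f a b n : ℂ))) =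
      structureFactor a b k (U.approximant a b l).ncard := by
    have hinj : Function.Injective fun i : ℕ => ((i + 1 : ℕ) : ℤ) :=
      Nat.cast_injective.comp (add_left_injective 1)
    rw [f_preimage_approximant ha hb, finsum_mem_image hinj.injOn, finsum_mem_coe_finset]
    exact sum_congr rfl fun i _ => by rw [weight, if_pos (by lia), one_mul]
  rw [nu, ← hsum]
  rfl

theorem isTheta_nuNormalized {k β : ℝ}
    (h : (fun n => structureFactor a b k n) =Θ[atTop] fun n : ℕ => (n : ℝ) ^ β)
    (U : AveragingSequence) (α : ℝ) :
    (fun l => nuNormalized a b U α l k) =Θ[atTop]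
      fun l => ((U.approximant a b l).ncard : ℝ) ^ (2 * β - 1 - α) := by
  have hcard := tendsto_ncard_approximant ha hb U
  have hsq := IsTheta.pow (IsTheta.norm_left ⟨h.1.comp_tendsto hcard, h.2.comp_tendsto hcard⟩) 2
  have hinv := isTheta_refl (fun l => 1 / ((U.approximant a b l).ncard : ℝ)) atTop
  have hpow := isTheta_refl (fun l => ((U.approximant a b l).ncard : ℝ) ^ α) atTop
  refine (EventuallyEq.isTheta (.of_forall fun l => ?_)).trans
    (((hinv.mul hsq).div hpow).trans (EventuallyEq.isTheta ?_))
  · simp only [nuNormalized, nu_eq_structureFactor ha hb, Function.comp_apply]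
  · filter_upwards [hcard.eventually_gt_atTop 0] with l hl
    have hn : (0 : ℝ) < (U.approximant a b l).ncard := Nat.cast_pos.2 hl
    rw [Function.comp_apply, Real.rpow_sub hn, Real.rpow_sub_one hn.ne', two_mul, Real.rpow_add hn]
    ring

end Approximants

section AGL

variable {a b k α β : ℝ}

instance : Nonempty AveragingSequence :=
  ⟨{lo := -1
    hi := 1
    lo_neg := neg_one_lt_zero
    hi_pos := one_pos
    ρ := fun l => (l : ℝ) + 1
    ρ_pos := fun l => by positivity
    ρ_strictMono := fun i j hij => by simpa using hij
    ρ_tendsto := tendsto_atTop_add_const_right _ _ tendsto_natCast_atTop_atTop}⟩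

theorem IsAGLExponent.limsup_pos_and_lt_top (h : IsAGLExponent a b k α) (U : AveragingSequence) :
    0 < limsup (fun l => ENNReal.ofReal (nuNormalized a b U α l k)) atTop ∧
      limsup (fun l => ENNReal.ofReal (nuNormalized a b U α l k)) atTop < ⊤ := by
  obtain ⟨hne, heq⟩ := h.2 U
  by_cases hinf : liminf (fun l => ENNReal.ofReal (nuNormalized a b U α l k)) atTop = 0
  · exact heq hinf
  · obtain ⟨hpos, hle, hlt⟩ := hne hinf
    exact ⟨hpos.trans_le hle, hlt⟩

theorem IsAGLExponent.not_tendsto_zero (h : IsAGLExponent a b k α) (U : AveragingSequence) :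
    ¬ Tendsto (fun l => nuNormalized a b U α l k) atTop (𝓝 0) := fun hlim =>
  (h.limsup_pos_and_lt_top U).1.ne' <|
    (ENNReal.tendsto_ofReal hlim).limsup_eq.trans ENNReal.ofReal_zero

theorem IsAGLExponent.not_tendsto_atTop (h : IsAGLExponent a b k α) (U : AveragingSequence) :
    ¬ Tendsto (fun l => nuNormalized a b U α l k) atTop atTop := fun hlim =>
  (h.limsup_pos_and_lt_top U).2.ne (ENNReal.tendsto_ofReal_atTop.comp hlim).limsup_eq

theorem nuNormalized_nonneg (U : AveragingSequence) (l : ℕ) : 0 ≤ nuNormalized a b U α l k := by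
  rw [nuNormalized, nu]
  positivity

theorem isTheta_nuNormalized_one (ha : 0 < a) (hb : 0 < b)
    (h : (fun n => structureFactor a b k n) =Θ[atTop] fun n : ℕ => (n : ℝ) ^ β)
    (U : AveragingSequence) :
    (fun l => nuNormalized a b U (2 * β - 1) l k) =Θ[atTop] fun _ => (1 : ℝ) := by
  simpa using isTheta_nuNormalized ha hb h U (2 * β - 1)

theorem isAGLExponent_of_isTheta_structureFactor (ha : 0 < a) (hb : 0 < b)
    (hβ : β ∈ Set.Ioo (0 : ℝ) 1)
    (h : (fun n => structureFactor a b k n) =Θ[atTop] fun n : ℕ => (n : ℝ) ^ β) :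
    IsAGLExponent a b k (2 * β - 1) := by
  refine ⟨⟨by linarith [hβ.1], by linarith [hβ.2]⟩, fun U => ?_⟩
  obtain ⟨hinf, hsup⟩ := liminf_pos_and_limsup_lt_top_of_isTheta_one
    (fun l => nuNormalized_nonneg U l) (isTheta_nuNormalized_one ha hb h U)
  exact ⟨fun _ => ⟨hinf, liminf_le_limsup, hsup⟩, fun h0 => (hinf.ne' h0).elim⟩

theorem IsAGLExponent.eq_of_isTheta_structureFactor (hα : IsAGLExponent a b k α) (ha : 0 < a)
    (hb : 0 < b) (h : (fun n => structureFactor a b k n) =Θ[atTop] fun n : ℕ => (n : ℝ) ^ β) :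
    α = 2 * β - 1 := by
  obtain ⟨U⟩ := (inferInstance : Nonempty AveragingSequence)
  have hcard : Tendsto (fun l => ((U.approximant a b l).ncard : ℝ)) atTop atTop :=
    tendsto_natCast_atTop_atTop.comp (tendsto_ncard_approximant ha hb U)
  have hnu := isTheta_nuNormalized ha hb h U α
  rcases lt_trichotomy α (2 * β - 1) with hlt | heq | hgt
  · have hpow := (tendsto_rpow_atTop (sub_pos.2 hlt)).comp hcard
    have hnorm := hnu.tendsto_norm_atTop_iff.2 (tendsto_norm_atTop_atTop.comp hpow)
    refine absurd (hnorm.congr fun l => ?_) (hα.not_tendsto_atTop U)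
    exact Real.norm_of_nonneg (nuNormalized_nonneg U l)
  · exact heq
  · have hpow := (tendsto_rpow_neg_atTop (sub_pos.2 hgt)).comp hcard
    rw [neg_sub] at hpow
    exact absurd (hnu.tendsto_zero_iff.2 hpow) (hα.not_tendsto_zero U)

theorem not_hasExtinctionProperty_of_isTheta_structureFactor (ha : 0 < a) (hb : 0 < b)
    (h : (fun n => structureFactor a b k n) =Θ[atTop] fun n : ℕ => (n : ℝ) ^ β)
    (V : AveragingSequence) : ¬ HasExtinctionProperty a b k (2 * β - 1) V := fun hV =>
  one_ne_zero <| tendsto_nhds_unique tendsto_const_nhds <|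
    (isTheta_nuNormalized_one ha hb h V).tendsto_zero_iff.1 hV

end AGL

end ThueMorse

theorem mainTheorem9_general {a b : ℝ} (ha : 0 < a) (hb : 0 < b) {t : ℤ} {p : ℕ} (hp : Odd p)
    (hp3 : 3 ≤ p) {k : ℝ} (hk : k = 4 * Real.pi / (a + b) * ((t : ℝ) / (p : ℝ)))
    (hκ : ThueMorse.kappaEta a b k ≠ 0) (hR : (0 : ℂ) ∉ ThueMorse.rarefactionDomain p t) :
    (ThueMorse.IsAGLExponent a b k (ThueMorse.alpha p) ∧
      ∀ α : ℝ, ThueMorse.IsAGLExponent a b k α → α = ThueMorse.alpha p) ∧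
    ¬ ∃ V : ThueMorse.AveragingSequence,
      ThueMorse.HasExtinctionProperty a b k (ThueMorse.alpha p) V := by
  have hΘ := ThueMorse.isTheta_structureFactor (add_pos ha hb).ne' hp hp3 hk hκ hR
  have hβ := ThueMorse.beta_mem_Ioo hp hp3
  exact ⟨⟨ThueMorse.isAGLExponent_of_isTheta_structureFactor ha hb hβ hΘ,
    fun _ hα => hα.eq_of_isTheta_structureFactor ha hb hΘ⟩,
    fun ⟨V, hV⟩ => ThueMorse.not_hasExtinctionProperty_of_isTheta_structureFactor ha hb hΘ V hV⟩

theorem mainTheorem9 (a b : ℝ) (hb : 0 < b) (hab : b < a)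
    (t : ℤ) (p : ℕ) (hp : Odd p) (hp3 : 3 ≤ p) (htp : IsCoprime t (p : ℤ))
    (k : ℝ) (hk : k = 4 * Real.pi / (a + b) * ((t : ℝ) / (p : ℝ)))
    (hkS : k ∈ ThueMorse.singularSet a b)
    (hR : (0 : ℂ) ∉ ThueMorse.rarefactionDomain p t) :
    (ThueMorse.IsAGLExponent a b k (ThueMorse.alpha p) ∧
      ∀ α : ℝ, ThueMorse.IsAGLExponent a b k α → α = ThueMorse.alpha p) ∧
    ¬ ∃ V : ThueMorse.AveragingSequence,
      ThueMorse.HasExtinctionProperty a b k (ThueMorse.alpha p) V := by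
  obtain ⟨_, _, _, _, _, _, _, hκ⟩ := hkS
  exact mainTheorem9_general (hb.trans hab) hb hp hp3 hk hκ hR
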